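/- Let $M$ be a matroid on a finite ground set $E$ that has at least two bases, let $\mathcal F$ be the set of its bases, and let $r\ge 1$ be its rank. The bases-exchange walk on $M$ is the Markov chain on $\mathcal F$ which moves from $B\in\mathcal F$ as follows: choose $e\in B$ uniformly at random; choose $f$ uniformly at random from the set $\{f\in E : (B\setminus\{e\})\cup\{f\}\in\mathcal F\}$; move to $(B\setminus\{e\})\cup\{f\}$. Let $P$ be its transition matrix. Then all the eigenvalues of $P$ are real and, writing them with multiplicity as $\lambda_1\ge\lambda_2\ge\cdots\ge\lambda_{|\mathcal F|}$, the spectral gap $\gamma(P)=1-\lambda_2$ satisfies $$\gamma(P)\ \ge\ \frac1r .$$ -/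

import Mathlib

namespace BasesExchange

/-- The state space of the walk: the collection of bases of the matroid `M`
(for a matroid on a finite ground set, every basis is a finite set). -/
abbrev Bases {α : Type*} (M : Matroid α) : Type _ :=
  {B : Finset α // M.IsBase (B : Set α)}

/-- A matroid on a finite ground set has finitely many bases. -/
theorem finite_bases {α : Type*} (M : Matroid α) [M.Finite] : Finite (Bases M) := by
  have h : {B : Finset α | B ⊆ M.ground_finite.toFinset}.Finite := by
    refine (M.ground_finite.toFinset.powerset.finite_toSet).subset ?_
    intro B hB
    simpa using hB
  refine Set.Finite.subset h ?_
  intro B hB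
  show B ⊆ M.ground_finite.toFinset
  intro x hx
  exact M.ground_finite.mem_toFinset.mpr (Matroid.IsBase.subset_ground hB hx)

noncomputable instance instFintypeBases {α : Type*} (M : Matroid α) [M.Finite] : Fintype (Bases M) :=
  @Fintype.ofFinite _ (finite_bases M)

noncomputable instance instDecidableEqBases {α : Type*} (M : Matroid α) : DecidableEq (Bases M) :=
  Classical.decEq _

open scoped Classical in
/-- The set obtained from `B` by removing `e` and then adding `f`. -/
noncomputable def exchange {α : Type*} (B : Finset α) (e f : α) : Finset α :=
  insert f (B.erase e)

open scoped Classical in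
/-- The elements `f` of the ground set that can be added to `B \ {e}` so that the result is
again a basis. For `e ∈ B` this contains `e` itself. -/
noncomputable def exchangeSet {α : Type*} (M : Matroid α) [M.Finite] (B : Finset α) (e : α) :
    Finset α :=
  M.ground_finite.toFinset.filter fun f => M.IsBase (exchange B e f : Set α)

open scoped Classical in
/-- The transition matrix of the bases-exchange walk: from the basis `A`, choose `e ∈ A` uniformly
at random, then choose `f ∈ exchangeSet M A e` uniformly at random, and move to
`(A \ {e}) ∪ {f}`. The `(A, B)` entry is the probability of moving from `A` to `B`. -/
noncomputable def transitionMatrix {α : Type*} (M : Matroid α) [M.Finite] :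
    Matrix (Bases M) (Bases M) ℝ :=
  Matrix.of fun A B =>
    ∑ e ∈ A.1, (1 / (A.1.card : ℝ)) *
      ∑ f ∈ exchangeSet M A.1 e, (1 / ((exchangeSet M A.1 e).card : ℝ)) *
        (if exchange A.1 e f = B.1 then 1 else 0)

/-- The real eigenvalues of a square matrix, repeated according to their (algebraic) multiplicity,
in decreasing order. -/
noncomputable def eigenvalueList {ι : Type*} [Fintype ι] [DecidableEq ι] (P : Matrix ι ι ℝ) :
    List ℝ :=
  P.charpoly.roots.sort (· ≥ ·)

/-- The spectral gap `1 - λ₂`, where `λ₁ ≥ λ₂ ≥ ⋯` are the eigenvalues of the transition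
matrix `P`, counted with multiplicity. It is meaningful when all eigenvalues of `P` are real
and there are at least two states. -/
noncomputable def spectralGap {ι : Type*} [Fintype ι] [DecidableEq ι] (P : Matrix ι ι ℝ) : ℝ :=
  1 - (eigenvalueList P).getD 1 0

end BasesExchange

/-! Removing a random element of `A` and adding a random one back passes through an independent set
of corank one, so P = (1/r) Σ_I N(I)⁻¹ 1_I 1_Iᵀ, where I runs over the sets of size r - 1 contained
in a basis, N(I) counts the bases containing I and 1_I is their indicator. Hence P is symmetric, and
its quadratic form at φ is S_{r-1}/r, where S_s is the sum of `moment` over the sets of size s and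
S_r = ‖φ‖². By Courant–Fischer it suffices that S_{r-1} ≤ (r - 1) S_r whenever φ has zero sum.

Let a_s = S_s / C(r, s); up to the factor |F| this is the second moment of the average of φ over the
bases containing a random s-subset of a random basis. The sequence a_s is convex (`moment_convex`,
`sum_moment_convex`), and a_0 = 0 for zero-sum φ. So a_s / s is nondecreasing, and its last step is
the required bound (`sum_moment_le_succ`).

Convexity is local: in the link of I, a weighted sum of squares is nonnegative, and its one
uncontrolled term is bounded because the link's weighted graph has at most one positive eigenvalue
(`lorentzianOn_pairSum`). In corank two the link is a complete multipartite graph, whose parts are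
parallel classes; Oppenheim's trickle-down carries the property to larger corank, using only that
links are connected. Both matroid inputs come from augmentation. -/

namespace BasesExchange

/-! ### Symmetric matrices and the second eigenvalue -/

/-- A symmetric real matrix has an orthonormal family of eigenvectors that diagonalizes its
quadratic form. -/
theorem exists_orthonormal_eigenvectors {ι : Type*} [Fintype ι] [DecidableEq ι]
    {A : Matrix ι ι ℝ} (hA : A.IsHermitian) :
    ∃ v : ι → ι → ℝ, (∀ k l, ∑ i, v k i * v l i = if k = l then 1 else 0) ∧
      (∀ k i, ∑ j, A i j * v k j = hA.eigenvalues k * v k i) ∧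
      ∀ y : ι → ℝ, ∑ i, ∑ j, A i j * y i * y j =
        ∑ k, hA.eigenvalues k * (∑ i, v k i * y i) ^ 2 := by
  have hv : ∀ k i, ∑ j, A i j * hA.eigenvectorBasis k j
      = hA.eigenvalues k * hA.eigenvectorBasis k i := by
    intro k i
    have := congrFun (hA.mulVec_eigenvectorBasis k) i
    simpa [Matrix.mulVec, dotProduct] using this
  refine ⟨fun k => hA.eigenvectorBasis k, ?_, hv, ?_⟩
  · intro k l
    have := orthonormal_iff_ite.mp hA.eigenvectorBasis.orthonormal k l
    rw [← this, PiLp.inner_apply]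
    simp [mul_comm]
  · intro y
    have hy : ∀ j, y j = ∑ k, (∑ i, hA.eigenvectorBasis k i * y i) * hA.eigenvectorBasis k j := by
      intro j
      have := congrArg (fun z : EuclideanSpace ℝ ι => z j)
        (hA.eigenvectorBasis.sum_repr' (WithLp.toLp 2 y))
      simp only [PiLp.inner_apply] at this
      simpa [mul_comm] using this.symm
    have hAy : ∀ i, ∑ j, A i j * y j = ∑ k, (∑ i, hA.eigenvectorBasis k i * y i) *
        (hA.eigenvalues k * hA.eigenvectorBasis k i) := by
      intro i
      conv_lhs => enter [2, j]; rw [hy j]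
      simp only [Finset.mul_sum, ← hv]
      rw [Finset.sum_comm]
      refine Finset.sum_congr rfl fun k _ => Finset.sum_congr rfl fun j _ => ?_
      simp only [Finset.sum_mul, Finset.mul_sum]
      exact Finset.sum_congr rfl fun _ _ => by ring
    calc ∑ i, ∑ j, A i j * y i * y j = ∑ i, y i * ∑ j, A i j * y j := by
          refine Finset.sum_congr rfl fun i _ => ?_
          rw [Finset.mul_sum]
          exact Finset.sum_congr rfl fun _ _ => by ring
      _ = ∑ k, hA.eigenvalues k * (∑ i, hA.eigenvectorBasis k i * y i) ^ 2 := by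
          simp only [hAy]
          simp only [Finset.mul_sum]
          rw [Finset.sum_comm]
          refine Finset.sum_congr rfl fun k _ => ?_
          set c := ∑ i, hA.eigenvectorBasis k i * y i with hc
          have : ∀ i, y i * (c * (hA.eigenvalues k * hA.eigenvectorBasis k i))
              = hA.eigenvalues k * c * (hA.eigenvectorBasis k i * y i) := fun i => by ring
          simp only [this, ← Finset.mul_sum, ← hc]
          ring

/-- If the quadratic form of a symmetric matrix is at most `c ‖x‖²` on the vectors with zero sum,
then its second largest eigenvalue is at most `c`. -/
theorem eigenvalueList_getD_one_le {ι : Type*} [Fintype ι] [DecidableEq ι]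
    {A : Matrix ι ι ℝ} (hA : A.IsHermitian) (hι : 2 ≤ Fintype.card ι) (c : ℝ)
    (h : ∀ x : ι → ℝ, ∑ i, x i = 0 → ∑ i, ∑ j, A i j * x i * x j ≤ c * ∑ i, x i ^ 2) :
    (eigenvalueList A).getD 1 0 ≤ c := by
  have hl : eigenvalueList A = List.ofFn hA.eigenvalues₀ := by
    rw [← hA.sort_roots_charpoly_eq_eigenvalues₀, eigenvalueList]
    simp
  have h1 : (eigenvalueList A).getD 1 0 = hA.eigenvalues₀ ⟨1, hι⟩ := by
    rw [hl, List.getD_eq_getElem _ _ (by rw [List.length_ofFn]; omega)]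
    simp
  rw [h1]
  by_contra! hc
  have hc0 : c < hA.eigenvalues₀ ⟨0, by omega⟩ :=
    hc.trans_le (hA.eigenvalues₀_antitone (by simp))
  obtain ⟨v, ho, hv, hq⟩ := exists_orthonormal_eigenvectors hA
  set e : Fin (Fintype.card ι) ≃ ι := Fintype.equivOfCardEq (Fintype.card_fin _)
  have hev : ∀ n, hA.eigenvalues (e n) = hA.eigenvalues₀ n := by
    intro n
    simp [Matrix.IsHermitian.eigenvalues, e]
  obtain ⟨k, l, hkl, hk, hl⟩ : ∃ k l, k ≠ l ∧ c < hA.eigenvalues k ∧ c < hA.eigenvalues l := by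
    refine ⟨e ⟨0, by omega⟩, e ⟨1, hι⟩, ?_, by rwa [hev], by rwa [hev]⟩
    simp
  -- On the span of two eigenvectors with eigenvalues above c the form exceeds c‖x‖² unless x = 0,
  -- so the span contains no nonzero zero-sum vector.
  have key : ∀ a b : ℝ, a * ∑ i, v k i + b * ∑ i, v l i = 0 → a ^ 2 + b ^ 2 = 0 := by
    intro a b hab
    have hx := h (fun i => a * v k i + b * v l i) (by
      rw [Finset.sum_add_distrib, ← Finset.mul_sum, ← Finset.mul_sum, hab])
    have hn : ∑ i, (a * v k i + b * v l i) ^ 2 = a ^ 2 + b ^ 2 := by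
      have : ∀ i, (a * v k i + b * v l i) ^ 2 = a ^ 2 * (v k i * v k i)
          + 2 * a * b * (v k i * v l i) + b ^ 2 * (v l i * v l i) := fun i => by ring
      simp only [this, Finset.sum_add_distrib, ← Finset.mul_sum, ho, hkl]
      simp
    have hc : ∀ n, ∑ i, v n i * (a * v k i + b * v l i)
        = (if n = k then a else 0) + (if n = l then b else 0) := by
      intro n
      have : ∀ i, v n i * (a * v k i + b * v l i) = a * (v n i * v k i) + b * (v n i * v l i) :=
        fun i => by ring
      simp only [this, Finset.sum_add_distrib, ← Finset.mul_sum, ho]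
      simp
    have hs : ∀ n, hA.eigenvalues n *
        ((if n = k then a else 0) + (if n = l then b else 0)) ^ 2
        = (if n = k then hA.eigenvalues k * a ^ 2 else 0)
          + (if n = l then hA.eigenvalues l * b ^ 2 else 0) := by
      intro n
      by_cases h1 : n = k
      · subst h1; simp [hkl]
      · by_cases h2 : n = l
        · subst h2; simp [h1]
        · simp [h1, h2]
    rw [hq, hn] at hx
    simp only [hc, hs, Finset.sum_add_distrib] at hx
    simp only [Finset.sum_ite_eq', Finset.mem_univ, if_true] at hx
    by_contra hne
    rcases eq_or_ne a 0 with rfl | ha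
    · have : 0 < b ^ 2 := by
        have : b ≠ 0 := by rintro rfl; simp at hne
        positivity
      nlinarith
    · have : 0 < a ^ 2 := by positivity
      nlinarith [sq_nonneg b]
  -- A plane always meets the zero-sum hyperplane: this combination has zero sum, which forces Σ v_l
  -- = 0, and then v_l itself is a nonzero zero-sum vector.
  have h2 := key (∑ i, v l i) (-∑ i, v k i) (by ring)
  have h3 : ∑ i, v l i = 0 := by nlinarith [sq_nonneg (∑ i, v l i), sq_nonneg (∑ i, v k i)]
  have := key 0 1 (by simp [h3])
  norm_num at this

/-! ### Lorentzian forms and trickle-down -/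

/-- The Lorentzian inequality on the finite set `V`: with respect to the symmetric form `W`, the
reverse Cauchy-Schwarz inequality holds between the constant function `1` and any function. -/
def LorentzianOn {α : Type*} (V : Finset α) (W : α → α → ℝ) : Prop :=
  ∀ f : α → ℝ, (∑ i ∈ V, ∑ j ∈ V, W i j) * (∑ i ∈ V, ∑ j ∈ V, W i j * f i * f j) ≤
    (∑ i ∈ V, (∑ j ∈ V, W i j) * f i) ^ 2

/-- Negativity on one hyperplane that misses the constants is enough, since every f is moved into it
by subtracting a constant. The hyperplane is left free: the row sums serve for trickle-down, an
indicator in corank two. -/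
theorem LorentzianOn.of_ker {α : Type*} {V : Finset α} {W : α → α → ℝ}
    (hs : ∀ i j, W i j = W j i) (h0 : 0 ≤ ∑ i ∈ V, ∑ j ∈ V, W i j) (p : α → ℝ)
    (hp : ∑ i ∈ V, ∑ j ∈ V, W i j ≠ 0 → ∑ i ∈ V, p i ≠ 0)
    (h : ∀ f : α → ℝ, ∑ i ∈ V, p i * f i = 0 → ∑ i ∈ V, ∑ j ∈ V, W i j * f i * f j ≤ 0) :
    LorentzianOn V W := by
  intro f
  rcases h0.eq_or_lt with h0 | h0
  · rw [← h0, zero_mul]; positivity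
  have hp' := hp h0.ne'
  set c := (∑ i ∈ V, p i * f i) / ∑ i ∈ V, p i with hc
  have h1 := h (fun i => f i - c) (by
    simp only [mul_sub, Finset.sum_sub_distrib, ← Finset.sum_mul]
    rw [hc]; field_simp; ring)
  set T := ∑ i ∈ V, ∑ j ∈ V, W i j
  set L := ∑ i ∈ V, (∑ j ∈ V, W i j) * f i with hL
  have hL1 : ∑ i ∈ V, ∑ j ∈ V, W i j * f i = L := by
    rw [hL]; exact Finset.sum_congr rfl fun i _ => by rw [Finset.sum_mul]
  have hL2 : ∑ i ∈ V, ∑ j ∈ V, W i j * f j = L := by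
    rw [← hL1, Finset.sum_comm]
    exact Finset.sum_congr rfl fun i _ => Finset.sum_congr rfl fun j _ => by rw [hs]
  set Q := ∑ i ∈ V, ∑ j ∈ V, W i j * f i * f j with hQ
  have h2 : ∑ i ∈ V, ∑ j ∈ V, W i j * (f i - c) * (f j - c) = Q - c * L - c * L + c ^ 2 * T := by
    have : ∀ i j, W i j * (f i - c) * (f j - c)
        = W i j * f i * f j - c * (W i j * f i) - c * (W i j * f j) + c ^ 2 * W i j :=
      fun i j => by ring
    simp only [this, Finset.sum_add_distrib, Finset.sum_sub_distrib, ← Finset.mul_sum, hL1, hL2]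
    rfl
  rw [h2] at h1
  -- Multiplying Q - 2cL + c²T ≤ 0 by T gives TQ ≤ L² - (Tc - L)².
  nlinarith [sq_nonneg (T * c - L)]

theorem sum_mul_sub_sq {ι : Type*} [Fintype ι] {W : ι → ι → ℝ} (hs : ∀ i j, W i j = W j i)
    (f : ι → ℝ) : ∑ i, ∑ j, W i j * (f i - f j) ^ 2
      = 2 * (∑ i, (∑ j, W i j) * f i ^ 2) - 2 * ∑ i, ∑ j, W i j * f i * f j := by
  have h1 : ∑ i, ∑ j, W i j * f i ^ 2 = ∑ i, (∑ j, W i j) * f i ^ 2 :=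
    Finset.sum_congr rfl fun i _ => by rw [Finset.sum_mul]
  have h2 : ∑ i, ∑ j, W i j * f j ^ 2 = ∑ i, (∑ j, W i j) * f i ^ 2 := by
    rw [← h1, Finset.sum_comm]
    exact Finset.sum_congr rfl fun i _ => Finset.sum_congr rfl fun j _ => by rw [hs]
  have : ∀ i j, W i j * (f i - f j) ^ 2
      = W i j * f i ^ 2 + W i j * f j ^ 2 - 2 * (W i j * f i * f j) := fun i j => by ring
  simp only [this, Finset.sum_add_distrib, Finset.sum_sub_distrib, ← Finset.mul_sum, h1, h2]
  ring

/-- Oppenheim's trickle-down theorem in the extremal case, on a finite type. -/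
theorem quadForm_nonpos_of_trickle {ι : Type*} [Fintype ι] {W : ι → ι → ℝ}
    (hs : ∀ i j, W i j = W j i) (h0 : ∀ i j, 0 ≤ W i j)
    (hc : ∀ f : ι → ℝ, (∀ i j, W i j ≠ 0 → f i = f j) →
      ∀ i j, ∑ k, W i k ≠ 0 → ∑ k, W j k ≠ 0 → f i = f j)
    (hT : ∀ f : ι → ℝ, ∑ i, ∑ j, W i j * f i * f j ≤ ∑ i, (∑ j, W i j * f j) ^ 2 / ∑ j, W i j)
    (f : ι → ℝ) (hf : ∑ i, (∑ j, W i j) * f i = 0) : ∑ i, ∑ j, W i j * f i * f j ≤ 0 := by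
  classical
  set p : ι → ℝ := fun i => ∑ j, W i j with hp
  have hp0 : ∀ i, 0 ≤ p i := fun i => Finset.sum_nonneg fun j _ => h0 i j
  have hWp : ∀ i j, p i = 0 → W i j = 0 := fun i j h =>
    (Finset.sum_eq_zero_iff_of_nonneg fun j _ => h0 i j).mp h j (Finset.mem_univ _)
  have hsq : ∀ i, √(p i) * √(p i) = p i := fun i => Real.mul_self_sqrt (hp0 i)
  have hs0 : ∀ i, p i ≠ 0 → √(p i) ≠ 0 := fun i h =>
    (Real.sqrt_pos.mpr (lt_of_le_of_ne (hp0 i) h.symm)).ne'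
  have hWs : ∀ i j, W i j / (√(p i) * √(p j)) * √(p i) * √(p j) = W i j := by
    intro i j
    by_cases hi : p i = 0
    · simp [hWp i j hi]
    by_cases hj : p j = 0
    · simp [hs i j, hWp j i hj]
    have := hs0 i hi
    have := hs0 j hj
    field_simp
  -- The normalised matrix D^{-1/2} W D^{-1/2}, with D the diagonal of row sums; division by zero
  -- makes the rows of isolated vertices vanish.
  let A : Matrix ι ι ℝ := Matrix.of fun i j => W i j / (√(p i) * √(p j))
  have hA : A.IsHermitian := by
    ext i j
    simp [A, hs i j, mul_comm]
  obtain ⟨v, ho, hv, hq⟩ := exists_orthonormal_eigenvectors hA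
  have hform : ∑ i, ∑ j, W i j * f i * f j
      = ∑ i, ∑ j, A i j * (√(p i) * f i) * (√(p j) * f j) := by
    refine Finset.sum_congr rfl fun i _ => Finset.sum_congr rfl fun j _ => ?_
    simp only [A, Matrix.of_apply]
    conv_lhs => rw [← hWs i j]
    ring
  rw [hform, hq (fun i => √(p i) * f i)]
  refine Finset.sum_nonpos fun k _ => ?_
  set μ := hA.eigenvalues k
  let g : ι → ℝ := fun i => v k i / √(p i)
  have hWg : ∀ i, ∑ j, W i j * g j = μ * (p i * g i) := by
    intro i
    by_cases hi : p i = 0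
    · simp [hWp i _ hi, hi]
    have := hs0 i hi
    have h1 := hv k i
    have h2 : ∑ j, W i j * g j = √(p i) * ∑ j, A i j * v k j := by
      rw [Finset.mul_sum]
      refine Finset.sum_congr rfl fun j _ => ?_
      simp only [A, Matrix.of_apply, g]
      field_simp
    rw [h2, h1]
    simp only [g]
    nth_rewrite 2 [← hsq i]
    field_simp
    exact mul_comm _ _
  have hWgg : ∑ i, ∑ j, W i j * g i * g j = μ * ∑ i, p i * g i ^ 2 := by
    rw [Finset.mul_sum]
    refine Finset.sum_congr rfl fun i _ => ?_
    have : ∑ j, W i j * g i * g j = g i * ∑ j, W i j * g j := by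
      rw [Finset.mul_sum]
      exact Finset.sum_congr rfl fun _ _ => by ring
    rw [this, hWg]
    ring
  -- The hypothesis at the eigenfunction g = D^{-1/2} v_k reads μ‖g‖² ≤ μ²‖g‖² in the p-weighted
  -- norm, which leaves no eigenvalue strictly between 0 and 1.
  have hle2 : μ * ∑ i, p i * g i ^ 2 ≤ μ ^ 2 * ∑ i, p i * g i ^ 2 := by
    rw [← hWgg]
    refine (hT g).trans_eq ?_
    rw [Finset.mul_sum]
    refine Finset.sum_congr rfl fun i _ => ?_
    rw [hWg]
    by_cases hi : p i = 0
    · simp [hi]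
    · change _ / p i = _
      field_simp
  have hdir := sum_mul_sub_sq hs g
  rw [hWgg] at hdir
  change _ = 2 * ∑ i, p i * g i ^ 2 - _ at hdir
  have hdir0 : 0 ≤ ∑ i, ∑ j, W i j * (g i - g j) ^ 2 :=
    Finset.sum_nonneg fun i _ => Finset.sum_nonneg fun j _ => mul_nonneg (h0 i j) (sq_nonneg _)
  have hn0 : 0 ≤ ∑ i, p i * g i ^ 2 :=
    Finset.sum_nonneg fun i _ => mul_nonneg (hp0 i) (sq_nonneg _)
  rcases le_or_gt μ 0 with hμ | hμ
  · exact mul_nonpos_of_nonpos_of_nonneg hμ (sq_nonneg _)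
  have hvk : ∀ i, p i = 0 → v k i = 0 := by
    intro i hi
    have h1 := hv k i
    have h2 : ∑ j, A i j * v k j = 0 :=
      Finset.sum_eq_zero fun j _ => by simp [A, hWp i j hi]
    rw [h2] at h1
    exact (mul_eq_zero.mp h1.symm).resolve_left hμ.ne'
  have hvg : ∀ i, v k i = √(p i) * g i := by
    intro i
    by_cases hi : p i = 0
    · simp [hvk i hi, hi]
    · have := hs0 i hi
      simp only [g]; field_simp
  -- The Dirichlet form of g equals 2(1 - μ)‖g‖², so μ ≥ 1 makes it vanish and g is constant along
  -- edges.
  have hconst : ∀ i j, W i j ≠ 0 → g i = g j := by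
    have hz : ∑ i, ∑ j, W i j * (g i - g j) ^ 2 = 0 := by
      rcases hn0.eq_or_lt with hn | hn
      · rw [hdir, ← hn]; ring
      · have hμ1 : 1 ≤ μ := by
          by_contra! hlt
          nlinarith [mul_pos (mul_pos hμ hn) (sub_pos.mpr hlt)]
        nlinarith
    intro i j hij
    have h1 := (Finset.sum_eq_zero_iff_of_nonneg fun i _ => Finset.sum_nonneg fun j _ =>
      mul_nonneg (h0 i j) (sq_nonneg _)).mp hz i (Finset.mem_univ _)
    have h2 := (Finset.sum_eq_zero_iff_of_nonneg fun j _ =>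
      mul_nonneg (h0 i j) (sq_nonneg _)).mp h1 j (Finset.mem_univ _)
    have h3 := (mul_eq_zero.mp h2).resolve_left hij
    exact sub_eq_zero.mp (pow_eq_zero_iff two_ne_zero |>.mp h3)
  have hall := hc g hconst
  -- By connectivity v_k is a multiple of √p, which is orthogonal to √p · f by `hf`; thus positive
  -- eigenvalues contribute nothing.
  have hzero : ∑ i, v k i * (√(p i) * f i) = 0 := by
    by_cases hne : ∃ i, p i ≠ 0
    · obtain ⟨i₀, hi₀⟩ := hne
      have : ∀ i, v k i * (√(p i) * f i) = g i₀ * (p i * f i) := by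
        intro i
        by_cases hi : p i = 0
        · simp [hvk i hi, hi]
        · rw [hvg i, hall i i₀ hi hi₀]
          conv_rhs => rw [← hsq i]
          ring
      simp only [this, ← Finset.mul_sum]
      rw [hf, mul_zero]
    · push Not at hne
      exact Finset.sum_eq_zero fun i _ => by simp [hvk i (hne i)]
  rw [hzero]
  simp

/-- Oppenheim's trickle-down theorem in the extremal case: a connected weighted graph all of whose
links have no positive eigenvalue besides the trivial one inherits this property. -/
theorem LorentzianOn.of_trickle {α : Type*} {V : Finset α} {W : α → α → ℝ}
    (hs : ∀ i j, W i j = W j i) (h0 : ∀ i j, 0 ≤ W i j)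
    (hc : ∀ i ∈ V, ∀ j ∈ V, ∑ k ∈ V, W i k ≠ 0 → ∑ k ∈ V, W j k ≠ 0 → i ≠ j →
      W i j ≠ 0 ∨ ∃ k ∈ V, W i k ≠ 0 ∧ W j k ≠ 0)
    (hT : ∀ f : α → ℝ, ∑ i ∈ V, ∑ j ∈ V, W i j * f i * f j ≤
      ∑ i ∈ V, (∑ j ∈ V, W i j * f j) ^ 2 / ∑ j ∈ V, W i j) :
    LorentzianOn V W := by
  classical
  refine .of_ker hs (Finset.sum_nonneg fun i _ => Finset.sum_nonneg fun j _ => h0 i j)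
    (fun i => ∑ j ∈ V, W i j) id fun f hf => ?_
  have hcoe : ∀ g : α → ℝ, ∑ i : V, g i = ∑ i ∈ V, g i := fun g => Finset.sum_coe_sort V g
  have hform : ∀ G : α → ℝ, ∑ i : V, ∑ j : V, W i j * G i * G j
      = ∑ i ∈ V, ∑ j ∈ V, W i j * G i * G j := fun G => by
    rw [← hcoe (fun i => ∑ j ∈ V, W i j * G i * G j)]
    exact Finset.sum_congr rfl fun i _ => hcoe (fun j => W i j * G i * G j)
  rw [← hform]
  refine quadForm_nonpos_of_trickle (ι := V) (W := fun i j => W i j) (fun i j => hs i j)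
    (fun i j => h0 i j) ?_ ?_ (fun i => f i) ?_
  · intro g hg i j hi hj
    rw [hcoe (fun k => W i k)] at hi
    rw [hcoe (fun k => W j k)] at hj
    rcases eq_or_ne i j with rfl | hij
    · rfl
    rcases hc i i.2 j j.2 hi hj (fun h => hij (Subtype.ext h)) with h | ⟨k, hk, h1, h2⟩
    · exact hg i j h
    · exact (hg i ⟨k, hk⟩ h1).trans (hg j ⟨k, hk⟩ h2).symm
  · intro g
    let G : α → ℝ := fun x => if hx : x ∈ V then g ⟨x, hx⟩ else 0
    have hG : ∀ i : V, g i = G i := fun i => by simp [G]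
    simp only [hG]
    rw [hform G]
    refine (hT G).trans_eq ?_
    rw [← hcoe (fun i => (∑ j ∈ V, W i j * G j) ^ 2 / ∑ j ∈ V, W i j)]
    refine Finset.sum_congr rfl fun i _ => ?_
    rw [hcoe (fun j => W i j * G j), hcoe (fun j => W i j)]
  · rw [← hf, ← hcoe (fun i => (∑ j ∈ V, W i j) * f i)]
    exact Finset.sum_congr rfl fun i _ => by rw [hcoe (fun j => W i j)]

/-! ### Basis families and sums over links -/

/-- `F` has the combinatorial properties of the family of bases of a matroid of rank `r` on `E`. -/
structure IsBasisFamily {α : Type*} [DecidableEq α] (E : Finset α) (F : Finset (Finset α))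
    (r : ℕ) : Prop where
  subset : ∀ B ∈ F, B ⊆ E
  card : ∀ B ∈ F, B.card = r
  augment : ∀ I J, (∃ B ∈ F, I ⊆ B) → (∃ B ∈ F, J ⊆ B) → I.card < J.card →
    ∃ x ∈ J, x ∉ I ∧ ∃ B ∈ F, insert x I ⊆ B

/-- The sum of `φ` over the members of `F` that contain `I`. -/
def upSum {α : Type*} [DecidableEq α] (F : Finset (Finset α)) (φ : Finset α → ℝ)
    (I : Finset α) : ℝ :=
  ∑ B ∈ F with I ⊆ B, φ B

/-- The sum of `φ` over the members of `F` that contain `I` and the distinct elements `i` and `j`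
outside of `I`. -/
def pairSum {α : Type*} [DecidableEq α] (F : Finset (Finset α)) (φ : Finset α → ℝ)
    (I : Finset α) (i j : α) : ℝ :=
  if i = j ∨ i ∈ I ∨ j ∈ I then 0 else upSum F φ (insert i (insert j I))

/-- The quadratic form of an equivalence relation is nonnegative. -/
theorem sum_sum_ite_eq_nonneg {α β : Type*} [DecidableEq β] (U : Finset α) (c : α → β) (g : α → ℝ) :
    0 ≤ ∑ i ∈ U, ∑ j ∈ U, if c i = c j then g i * g j else 0 := by
  have : ∑ i ∈ U, ∑ j ∈ U, (if c i = c j then g i * g j else 0)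
      = ∑ b ∈ U.image c, (∑ i ∈ U with c i = b, g i) ^ 2 := by
    rw [← Finset.sum_fiberwise_of_maps_to (t := U.image c) (g := c)
      (fun i hi => Finset.mem_image_of_mem c hi)]
    refine Finset.sum_congr rfl fun b _ => ?_
    rw [sq, Finset.sum_mul_sum]
    refine Finset.sum_congr rfl fun i hi => ?_
    rw [Finset.sum_filter]
    refine Finset.sum_congr rfl fun j _ => ?_
    rw [← (Finset.mem_filter.mp hi).2]
    simp only [eq_comm]
  rw [this]
  exact Finset.sum_nonneg fun _ _ => sq_nonneg _

section

variable {α : Type*} [DecidableEq α] {E : Finset α} {F : Finset (Finset α)} {r : ℕ}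

theorem upSum_one_nonneg (I : Finset α) : 0 ≤ upSum F 1 I :=
  Finset.sum_nonneg fun _ _ => zero_le_one

theorem upSum_one_ne_zero {I : Finset α} : upSum F 1 I ≠ 0 ↔ ∃ B ∈ F, I ⊆ B := by
  simp [upSum, Finset.filter_eq_empty_iff]

theorem upSum_eq_zero {I : Finset α} (h : upSum F 1 I = 0) (φ : Finset α → ℝ) :
    upSum F φ I = 0 := by
  refine Finset.sum_eq_zero fun B hB => ?_
  rw [Finset.mem_filter] at hB
  exact absurd h (upSum_one_ne_zero.mpr ⟨B, hB⟩)

theorem pairSum_comm (φ : Finset α → ℝ) (I : Finset α) (i j : α) :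
    pairSum F φ I i j = pairSum F φ I j i := by
  unfold pairSum
  rw [Finset.insert_comm]
  congr 1
  exact propext ⟨by rintro (h | h | h) <;> simp [h], by rintro (h | h | h) <;> simp [h]⟩

theorem pairSum_one_nonneg (I : Finset α) (i j : α) : 0 ≤ pairSum F 1 I i j := by
  unfold pairSum
  split_ifs
  exacts [le_rfl, upSum_one_nonneg _]

theorem pairSum_one_ne_zero {I : Finset α} {i j : α} :
    pairSum F 1 I i j ≠ 0 ↔ i ≠ j ∧ i ∉ I ∧ j ∉ I ∧ ∃ B ∈ F, insert i (insert j I) ⊆ B := by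
  unfold pairSum
  split_ifs with h
  · simp only [ne_eq, not_true_eq_false, false_iff]; tauto
  · rw [upSum_one_ne_zero]; tauto

namespace IsBasisFamily

variable (hF : IsBasisFamily E F r)
include hF

/-- Double counting: each basis containing I contains r - |I| further elements. The row sums and
link sums below are all instances of this identity. -/
theorem sum_upSum_insert (φ : Finset α → ℝ) (I : Finset α) :
    ∑ i ∈ E \ I, upSum F φ (insert i I) = ((r : ℝ) - I.card) * upSum F φ I := by
  simp only [upSum, Finset.sum_filter]
  rw [Finset.sum_comm, Finset.mul_sum]
  refine Finset.sum_congr rfl fun B hB => ?_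
  by_cases hI : I ⊆ B
  · have : ∀ i, insert i I ⊆ B ↔ i ∈ B := fun i => by simp [Finset.insert_subset_iff, hI]
    simp only [this, hI, if_true]
    rw [← Finset.sum_filter, Finset.sum_const]
    have h1 : (E \ I).filter (· ∈ B) = B \ I := by
      ext x
      have := @hF.subset B hB x
      simp only [Finset.mem_filter, Finset.mem_sdiff]
      tauto
    rw [h1, Finset.card_sdiff_of_subset hI, hF.card B hB, nsmul_eq_mul,
      Nat.cast_sub (hF.card B hB ▸ Finset.card_le_card hI)]
  · have : ∀ i, ¬ insert i I ⊆ B := fun i h => hI ((Finset.subset_insert i I).trans h)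
    simp [this, hI]

theorem sum_pairSum (φ : Finset α → ℝ) {I : Finset α} {i : α} (hi : i ∉ I) :
    ∑ j ∈ E, pairSum F φ I i j = ((r : ℝ) - I.card - 1) * upSum F φ (insert i I) := by
  have h := hF.sum_upSum_insert φ (insert i I)
  rw [Finset.card_insert_of_notMem hi] at h
  push_cast at h
  rw [sub_sub, ← h, ← Finset.sum_subset Finset.sdiff_subset (s₁ := E \ insert i I)]
  · refine Finset.sum_congr rfl fun j hj => ?_
    simp only [Finset.mem_sdiff, Finset.mem_insert, not_or] at hj
    rw [pairSum, if_neg (by simp [hi, hj.2.2, Ne.symm hj.2.1]), Finset.insert_comm]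
  · intro j hj hj'
    simp only [Finset.mem_sdiff, Finset.mem_insert, not_and, not_not] at hj'
    rw [pairSum, if_pos]
    rcases hj' hj with h | h <;> simp [h]

theorem sum_sum_pairSum (φ : Finset α → ℝ) (I : Finset α) :
    ∑ i ∈ E, ∑ j ∈ E, pairSum F φ I i j
      = ((r : ℝ) - I.card) * ((r : ℝ) - I.card - 1) * upSum F φ I := by
  rw [← Finset.sum_subset Finset.sdiff_subset (s₁ := E \ I)]
  · rw [mul_right_comm, ← hF.sum_upSum_insert, Finset.sum_mul]
    refine Finset.sum_congr rfl fun i hi => ?_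
    rw [hF.sum_pairSum φ (Finset.mem_sdiff.mp hi).2, mul_comm]
  · intro i hi hi'
    simp only [Finset.mem_sdiff, not_and, not_not] at hi'
    exact Finset.sum_eq_zero fun j _ => by simp [pairSum, hi' hi]

theorem sum_pairSum_insert (φ : Finset α → ℝ) (I : Finset α) (j k : α) :
    ∑ i ∈ E \ I, pairSum F φ (insert i I) j k = ((r : ℝ) - I.card - 2) * pairSum F φ I j k := by
  by_cases h : j = k ∨ j ∈ I ∨ k ∈ I
  · rw [pairSum, if_pos h, mul_zero]
    refine Finset.sum_eq_zero fun i _ => ?_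
    rw [pairSum, if_pos]
    rcases h with h | h | h <;> simp [h]
  · have h' := h
    push Not at h'
    have hs := hF.sum_upSum_insert φ (insert j (insert k I))
    rw [Finset.card_insert_of_notMem (by simp [h']), Finset.card_insert_of_notMem (by simp [h'])]
      at hs
    rw [pairSum, if_neg h]
    push_cast at hs
    have hr : (r : ℝ) - I.card - 2 = r - (I.card + 1 + 1) := by ring
    rw [hr, ← hs]
    symm
    refine Finset.sum_subset_zero_on_sdiff (fun i => by simp; tauto) ?_ ?_
    · intro i hi
      rw [pairSum, if_pos]
      simp only [Finset.mem_sdiff, Finset.mem_insert, not_and, not_or, not_not] at hi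
      simp only [Finset.mem_insert]
      by_contra hcon
      push Not at hcon
      exact hi.1.2 (hi.2 hi.1.1 (Ne.symm hcon.2.1.1) (Ne.symm hcon.2.2.1))
    · intro i hi
      simp only [Finset.mem_sdiff, Finset.mem_insert, not_or] at hi
      rw [pairSum, if_neg]
      · congr 1
        ext x
        simp only [Finset.mem_insert]
        tauto
      · simp only [Finset.mem_insert, not_or]
        exact ⟨h'.1, ⟨Ne.symm hi.2.1, h'.2.1⟩, ⟨Ne.symm hi.2.2.1, h'.2.2⟩⟩

theorem sum_pairSum_insert_right (φ : Finset α → ℝ) {I : Finset α} {i : α} (hi : i ∉ I) (j : α) :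
    ∑ k ∈ E, pairSum F φ (insert i I) j k = ((r : ℝ) - I.card - 2) * pairSum F φ I i j := by
  by_cases hj : j ∈ insert i I
  · rw [pairSum, if_pos, mul_zero]
    · exact Finset.sum_eq_zero fun k _ => by rw [pairSum, if_pos (Or.inr (Or.inl hj))]
    · rcases Finset.mem_insert.mp hj with h | h <;> simp [h]
  · rw [hF.sum_pairSum φ hj, Finset.card_insert_of_notMem hi, pairSum, if_neg, Finset.insert_comm]
    · push_cast; ring
    · simp only [Finset.mem_insert, not_or] at hj ⊢
      exact ⟨Ne.symm hj.1, hi, hj.2⟩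

/-! ### Local spectral bound for links -/

theorem exists_pairSum_ne_zero {I : Finset α} (hI : I.card + 2 ≤ r) {i j : α}
    (hi : i ∉ I) (hj : j ∉ I) (hij : i ≠ j) (hiB : ∃ B ∈ F, insert i I ⊆ B)
    (hjB : ∃ B ∈ F, insert j I ⊆ B) :
    pairSum F 1 I i j ≠ 0 ∨ ∃ k ∈ E, pairSum F 1 I i k ≠ 0 ∧ pairSum F 1 I j k ≠ 0 := by
  obtain ⟨B, hB, hIB⟩ := hiB
  obtain ⟨k, hkB, hk⟩ : ∃ k ∈ B, k ∉ insert i I := by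
    apply Finset.exists_mem_notMem_of_card_lt_card
    rw [Finset.card_insert_of_notMem hi, hF.card B hB]
    omega
  have hkI : insert k (insert i I) ⊆ B := Finset.insert_subset hkB hIB
  -- Augmenting I ∪ {j} from I ∪ {i, k} adds either i, so that i and j are adjacent, or k, a common
  -- neighbour.
  obtain ⟨x, hx, hxI, hxB⟩ := hF.augment (insert j I) (insert k (insert i I)) hjB ⟨B, hB, hkI⟩ (by
    rw [Finset.card_insert_of_notMem hj, Finset.card_insert_of_notMem hk,
      Finset.card_insert_of_notMem hi]
    omega)
  simp only [Finset.mem_insert, not_or] at hx hxI hk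
  rcases hx with rfl | rfl | hx
  · right
    refine ⟨x, hF.subset B hB hkB, pairSum_one_ne_zero.mpr ⟨Ne.symm hk.1, hi, hk.2, B, hB, ?_⟩,
      pairSum_one_ne_zero.mpr ⟨Ne.symm hxI.1, hj, hk.2, ?_⟩⟩
    · rwa [Finset.insert_comm]
    · rwa [Finset.insert_comm]
  · left
    exact pairSum_one_ne_zero.mpr ⟨hij, hi, hj, hxB⟩
  · exact absurd hx hxI.2

theorem pairSum_one_eq_one {I : Finset α} (hI : I.card + 2 = r) {i j : α}
    (h : pairSum F 1 I i j ≠ 0) : pairSum F 1 I i j = 1 := by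
  obtain ⟨hij, hi, hj, B, hB, hIB⟩ := pairSum_one_ne_zero.mp h
  rw [pairSum, if_neg (by tauto), upSum]
  have hc : (insert i (insert j I)).card = r := by
    rw [Finset.card_insert_of_notMem (by simp [hij, hi]), Finset.card_insert_of_notMem hj]
    omega
  have heq : ∀ B ∈ F, insert i (insert j I) ⊆ B → insert i (insert j I) = B := fun B hB h =>
    Finset.eq_of_subset_of_card_le h (by rw [hF.card B hB, hc])
  have : F.filter (insert i (insert j I) ⊆ ·) = {B} := by
    ext C
    simp only [Finset.mem_filter, Finset.mem_singleton]
    constructor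
    · rintro ⟨hC, h⟩
      rw [← heq C hC h, heq B hB hIB]
    · rintro rfl
      exact ⟨hB, hIB⟩
  simp [this]

/-- The link has rank two: on its nonloops, non-adjacency is parallelism, an equivalence relation.
The form is therefore (Σ f)² minus the sum of the squares of the class sums of f. -/
theorem lorentzianOn_pairSum_of_card_add_two_eq {I : Finset α} (hI : I.card + 2 = r) :
    LorentzianOn E (pairSum F 1 I) := by
  classical
  let U : Finset α := {i ∈ E | i ∉ I ∧ ∃ B ∈ F, insert i I ⊆ B}
  have hU : ∀ i ∈ E, ∀ j, pairSum F 1 I i j ≠ 0 → i ∈ U := by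
    intro i hiE j h
    obtain ⟨hij, hi, hj, B, hB, hIB⟩ := pairSum_one_ne_zero.mp h
    refine Finset.mem_filter.mpr ⟨hiE, hi, B, hB, (Finset.insert_subset_insert _ ?_).trans hIB⟩
    exact Finset.subset_insert _ _
  have hUp : ∀ G : α → α → ℝ, (∀ i j, pairSum F 1 I i j = 0 → G i j = 0) →
      ∑ i ∈ E, ∑ j ∈ E, G i j = ∑ i ∈ U, ∑ j ∈ U, G i j := by
    intro G hG
    have hUE : U ⊆ E := Finset.filter_subset _ _
    rw [← Finset.sum_subset hUE]
    · refine Finset.sum_congr rfl fun i _ => (Finset.sum_subset hUE fun j hj hjU => ?_).symm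
      refine hG i j (by_contra fun h => hjU (hU j hj i ?_))
      rwa [pairSum_comm]
    · exact fun i hi hiU => Finset.sum_eq_zero fun j _ =>
        hG i j (by_contra fun h => hiU (hU i hi j h))
  refine .of_ker (pairSum_comm 1 I)
    (Finset.sum_nonneg fun i _ => Finset.sum_nonneg fun j _ => pairSum_one_nonneg I i j)
    (fun i => if i ∈ U then 1 else 0) ?_ ?_
  · intro h h'
    apply h
    rw [hUp _ fun _ _ => id]
    have : U = ∅ := by
      rw [Finset.sum_boole, Nat.cast_eq_zero, Finset.card_eq_zero] at h'
      rw [← h']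
      ext i
      simp [U]
    simp [this]
  · intro f hf
    rw [hUp _ fun i j h => by simp [h]]
    -- Each element is labelled by its parallel class, so that equality of labels encodes the
    -- relation.
    let c : α → Finset α := fun i => {j ∈ U | pairSum F 1 I i j = 0}
    have hself : ∀ i, pairSum F 1 I i i = 0 := fun i => by simp [pairSum]
    have htrans : ∀ i ∈ U, ∀ j ∈ U, ∀ k ∈ U, pairSum F 1 I i j = 0 → pairSum F 1 I j k = 0 →
        pairSum F 1 I i k = 0 := by
      intro i hi j hj k hk hij hjk
      by_contra hik
      obtain ⟨hne, hiI, hkI, B, hB, hIB⟩ := pairSum_one_ne_zero.mp hik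
      obtain ⟨hjE, hjI, hjB⟩ := Finset.mem_filter.mp hj
      obtain ⟨x, hx, hxI, hxB⟩ := hF.augment (insert j I) (insert i (insert k I)) hjB ⟨B, hB, hIB⟩
        (by
          rw [Finset.card_insert_of_notMem hjI, Finset.card_insert_of_notMem (by simp [hne, hiI]),
            Finset.card_insert_of_notMem hkI]
          omega)
      simp only [Finset.mem_insert, not_or] at hx hxI
      rcases hx with rfl | rfl | hx
      · exact pairSum_one_ne_zero.mpr ⟨hxI.1, hiI, hjI, hxB⟩ hij
      · rw [pairSum_comm] at hjk
        exact pairSum_one_ne_zero.mpr ⟨hxI.1, hkI, hjI, hxB⟩ hjk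
      · exact hxI.2 hx
    have hc : ∀ i ∈ U, ∀ j ∈ U, (c i = c j ↔ pairSum F 1 I i j = 0) := by
      intro i hi j hj
      constructor
      · intro h
        have : j ∈ c i := h ▸ Finset.mem_filter.mpr ⟨hj, hself j⟩
        exact (Finset.mem_filter.mp this).2
      · intro h
        ext k
        simp only [c, Finset.mem_filter]
        refine and_congr_right fun hk => ⟨fun h' => ?_, htrans i hi j hj k hk h⟩
        rw [pairSum_comm] at h
        exact htrans j hj i hi k hk h h'
    have hsum : ∑ i ∈ U, ∑ j ∈ U, pairSum F 1 I i j * f i * f j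
        = (∑ i ∈ U, f i) ^ 2 - ∑ i ∈ U, ∑ j ∈ U, if c i = c j then f i * f j else 0 := by
      rw [sq, Finset.sum_mul_sum, ← Finset.sum_sub_distrib]
      refine Finset.sum_congr rfl fun i hi => ?_
      rw [← Finset.sum_sub_distrib]
      refine Finset.sum_congr rfl fun j hj => ?_
      by_cases h : pairSum F 1 I i j = 0
      · rw [if_pos ((hc i hi j hj).mpr h), h]; ring
      · rw [if_neg (fun h' => h ((hc i hi j hj).mp h')), hF.pairSum_one_eq_one hI h]; ring
    have h0 : ∑ i ∈ U, f i = 0 := by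
      rw [← hf]
      simp only [ite_mul, one_mul, zero_mul]
      rw [← Finset.sum_filter]
      refine Finset.sum_congr ?_ fun _ _ => rfl
      ext i
      simp [U]
    rw [hsum, h0]
    have := sum_sum_ite_eq_nonneg U c f
    linarith

/-- The local walks of the independence complex of a matroid have no positive eigenvalue besides
the trivial one. -/
theorem lorentzianOn_pairSum {I : Finset α} (hI : I.card + 2 ≤ r) :
    LorentzianOn E (pairSum F 1 I) := by
  obtain ⟨n, hn⟩ := Nat.exists_eq_add_of_le hI
  induction n generalizing I with
  | zero => exact hF.lorentzianOn_pairSum_of_card_add_two_eq hn.symm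
  | succ n ih =>
    have hm : (0 : ℝ) < (r : ℝ) - I.card - 2 := by
      rw [hn]; push_cast; linarith [n.cast_nonneg (α := ℝ)]
    have hout : ∀ i ∈ I, ∀ j, pairSum F 1 I i j = 0 := fun i hi j => by simp [pairSum, hi]
    have hp : ∀ i ∈ E \ I, ∑ j ∈ E, pairSum F 1 I i j
        = ((r : ℝ) - I.card - 1) * upSum F 1 (insert i I) := fun i hi =>
      hF.sum_pairSum 1 (Finset.mem_sdiff.mp hi).2
    refine .of_trickle (pairSum_comm 1 I) (pairSum_one_nonneg I) ?_ ?_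
    · intro i hiE j hjE hi hj hij
      have : ∀ i ∈ E, ∑ k ∈ E, pairSum F 1 I i k ≠ 0 → i ∉ I ∧ ∃ B ∈ F, insert i I ⊆ B := by
        intro i hiE hi
        have hiI : i ∉ I := fun h => hi (Finset.sum_eq_zero fun j _ => hout i h j)
        rw [hp i (Finset.mem_sdiff.mpr ⟨hiE, hiI⟩)] at hi
        exact ⟨hiI, upSum_one_ne_zero.mp (right_ne_zero_of_mul hi)⟩
      obtain ⟨hi, hiB⟩ := this i hiE hi
      obtain ⟨hj, hjB⟩ := this j hjE hj
      exact hF.exists_pairSum_ne_zero hI hi hj hij hiB hjB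
    · intro f
      refine le_of_mul_le_mul_left ?_ hm
      have h1 : ((r : ℝ) - I.card - 2) * ∑ i ∈ E, ∑ j ∈ E, pairSum F 1 I i j * f i * f j
          = ∑ x ∈ E \ I, ∑ i ∈ E, ∑ j ∈ E, pairSum F 1 (insert x I) i j * f i * f j := by
        rw [Finset.mul_sum]
        conv_rhs => rw [Finset.sum_comm]
        refine Finset.sum_congr rfl fun i _ => ?_
        rw [Finset.mul_sum]
        conv_rhs => rw [Finset.sum_comm]
        refine Finset.sum_congr rfl fun j _ => ?_
        rw [← Finset.sum_mul, ← Finset.sum_mul, hF.sum_pairSum_insert]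
        ring
      rw [h1, ← Finset.sum_subset Finset.sdiff_subset (s₁ := E \ I) (s₂ := E), Finset.mul_sum]
      · refine Finset.sum_le_sum fun x hx => ?_
        have hxI := (Finset.mem_sdiff.mp hx).2
        have hcard := Finset.card_insert_of_notMem hxI
        -- In the link of I ∪ {x} the row sums are (r - |I| - 2) W x j, so its reverse
        -- Cauchy–Schwarz inequality bounds its form by (r - |I| - 2)(Wf)_x² / p_x, with W =
        -- `pairSum F 1 I` and p its row sums. Summed over x, this is the trickle-down hypothesis.
        have hL := ih (I := insert x I) (by omega) (by omega) f
        have ht := hF.sum_sum_pairSum 1 (insert x I)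
        simp only [hF.sum_pairSum_insert_right 1 hxI] at hL ht
        rw [ht, hcard] at hL
        rw [hp x hx]
        set Q := ∑ i ∈ E, ∑ j ∈ E, pairSum F 1 (insert x I) i j * f i * f j
        set R := ∑ j ∈ E, pairSum F 1 I x j * f j with hR
        have hR' : ∑ i ∈ E, ((r : ℝ) - I.card - 2) * pairSum F 1 I x i * f i
            = ((r : ℝ) - I.card - 2) * R := by
          rw [hR, Finset.mul_sum]
          exact Finset.sum_congr rfl fun _ _ => by ring
        rw [hR'] at hL
        push_cast at hL
        rcases (upSum_one_nonneg (F := F) (insert x I)).eq_or_lt with h0 | h0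
        · have hQ : Q = 0 := by
            refine Finset.sum_eq_zero fun i _ => Finset.sum_eq_zero fun j _ => ?_
            have : pairSum F 1 (insert x I) i j = 0 := by
              by_contra h
              obtain ⟨-, -, -, B, hB, hIB⟩ := pairSum_one_ne_zero.mp h
              refine upSum_one_ne_zero.mpr ⟨B, hB, ?_⟩ h0.symm
              exact ((Finset.subset_insert _ _).trans (Finset.subset_insert _ _)).trans hIB
            simp [this]
          rw [hQ, ← h0]
          simp
        · have hm1 : (0 : ℝ) < (r : ℝ) - I.card - 1 := by linarith
          have hpos : 0 < ((r : ℝ) - I.card - 1) * upSum F 1 (insert x I) := mul_pos hm1 h0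
          rw [mul_div_assoc', le_div_iff₀ hpos]
          refine le_of_mul_le_mul_left ?_ hm
          calc _ = _ := ?_
            _ ≤ _ := hL
            _ = _ := by ring
          ring
      · intro i hi hiI
        have : i ∈ I := by simpa [hi] using hiI
        simp [hout i this]

end IsBasisFamily

/-! ### Convexity of the moments along levels -/

theorem sum_powersetCard_sum_insert (c : Finset α → ℝ) (s : ℕ) :
    ∑ I ∈ E.powersetCard s, ∑ i ∈ E \ I, c (insert i I)
      = ((s : ℝ) + 1) * ∑ K ∈ E.powersetCard (s + 1), c K := by
  have h : ((s : ℝ) + 1) * ∑ K ∈ E.powersetCard (s + 1), c K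
      = ∑ K ∈ E.powersetCard (s + 1), ∑ _i ∈ K, c K := by
    rw [Finset.mul_sum]
    refine Finset.sum_congr rfl fun K hK => ?_
    rw [Finset.sum_const, (Finset.mem_powersetCard.mp hK).2, nsmul_eq_mul]
    push_cast
    rfl
  rw [h, Finset.sum_sigma', Finset.sum_sigma']
  refine Finset.sum_nbij' (fun x => ⟨insert x.2 x.1, x.2⟩) (fun x => ⟨x.1.erase x.2, x.2⟩)
    ?_ ?_ ?_ ?_ ?_
  · rintro ⟨I, i⟩ hx
    simp only [Finset.mem_sigma, Finset.mem_powersetCard, Finset.mem_sdiff] at hx ⊢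
    obtain ⟨⟨hI, hs⟩, hi, hiI⟩ := hx
    exact ⟨⟨Finset.insert_subset hi hI, by rw [Finset.card_insert_of_notMem hiI, hs]⟩,
      Finset.mem_insert_self _ _⟩
  · rintro ⟨K, i⟩ hx
    simp only [Finset.mem_sigma, Finset.mem_powersetCard, Finset.mem_sdiff] at hx ⊢
    obtain ⟨⟨hK, hs⟩, hi⟩ := hx
    exact ⟨⟨(Finset.erase_subset _ _).trans hK, by rw [Finset.card_erase_of_mem hi, hs]; rfl⟩,
      hK hi, Finset.notMem_erase _ _⟩
  · rintro ⟨I, i⟩ hx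
    simp only [Finset.mem_sigma, Finset.mem_sdiff] at hx
    simp [Finset.erase_insert hx.2.2]
  · rintro ⟨K, i⟩ hx
    simp only [Finset.mem_sigma] at hx
    simp [Finset.insert_erase hx.2]
  · intro x _
    rfl

theorem sum_sum_ite_eq_sum_sdiff (G : Finset α → ℝ) (I : Finset α) :
    ∑ i ∈ E, ∑ j ∈ E, (if i = j ∨ i ∈ I ∨ j ∈ I then 0 else G (insert i (insert j I)))
      = ∑ i ∈ E \ I, ∑ j ∈ E \ insert i I, G (insert j (insert i I)) := by
  rw [← Finset.sum_subset Finset.sdiff_subset (s₁ := E \ I) (s₂ := E)]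
  · refine Finset.sum_congr rfl fun i hi => ?_
    rw [← Finset.sum_subset Finset.sdiff_subset (s₁ := E \ insert i I) (s₂ := E)]
    · refine Finset.sum_congr rfl fun j hj => ?_
      simp only [Finset.mem_sdiff, Finset.mem_insert, not_or] at hi hj
      rw [if_neg (by simp [hi, hj.2.2, Ne.symm hj.2.1]), Finset.insert_comm]
    · intro j hj hj'
      simp only [Finset.mem_sdiff, Finset.mem_insert, not_and, not_not] at hj'
      rw [if_pos]
      rcases hj' hj with h | h <;> simp [h]
  · intro i hi hi'
    simp only [Finset.mem_sdiff, not_and, not_not] at hi'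
    exact Finset.sum_eq_zero fun j _ => by simp [hi' hi]

theorem pairSum_eq_zero {I : Finset α} {i j : α} (h : pairSum F 1 I i j = 0)
    (φ : Finset α → ℝ) : pairSum F φ I i j = 0 := by
  unfold pairSum at h ⊢
  split_ifs at h ⊢
  exacts [rfl, upSum_eq_zero h φ]

/-- The mass of `I` in the second moment of the averages of `φ` over the sets of bases that contain
a given set. -/
noncomputable def moment (F : Finset (Finset α)) (φ : Finset α → ℝ) (I : Finset α) : ℝ :=
  upSum F φ I ^ 2 / upSum F 1 I

namespace IsBasisFamily

variable (hF : IsBasisFamily E F r)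
include hF

/-- The second moments of averages are convex along the levels of the link of `I`. -/
theorem moment_convex (φ : Finset α → ℝ) {I : Finset α} (hI : I.card + 2 ≤ r) :
    0 ≤ (∑ i ∈ E \ I, ∑ j ∈ E \ insert i I, moment F φ (insert j (insert i I)))
      - 2 * ((r : ℝ) - I.card - 1) * ∑ i ∈ E \ I, moment F φ (insert i I)
      + ((r : ℝ) - I.card) * ((r : ℝ) - I.card - 1) * moment F φ I := by
  rw [← sum_sum_ite_eq_sum_sdiff]
  set m : ℝ := (r : ℝ) - I.card with hm
  have hm1 : (0 : ℝ) < m - 1 := by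
    have : ((I.card + 2 : ℕ) : ℝ) ≤ r := by exact_mod_cast hI
    push_cast at this
    linarith
  set C : ℝ := upSum F φ I / upSum F 1 I with hC
  let h : α → ℝ := fun i => upSum F φ (insert i I) / upSum F 1 (insert i I)
  let W := pairSum F 1 I
  let g : α → α → ℝ := fun i j => pairSum F φ I i j / pairSum F 1 I i j
  have hWg : ∀ i j, W i j * g i j = pairSum F φ I i j := by
    intro i j
    by_cases hw : pairSum F 1 I i j = 0
    · simp [W, g, hw, pairSum_eq_zero hw]
    · simp only [W, g]; field_simp
  have hNh : ∀ i, upSum F 1 (insert i I) * h i = upSum F φ (insert i I) := by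
    intro i
    by_cases hw : upSum F 1 (insert i I) = 0
    · simp [hw, upSum_eq_zero hw]
    · simp only [h]; field_simp
  have hNC : upSum F 1 I * C = upSum F φ I := by
    by_cases hw : upSum F 1 I = 0
    · simp [hw, upSum_eq_zero hw]
    · simp only [hC]; field_simp
  have hmom : C * upSum F φ I = moment F φ I := by rw [hC, moment]; ring
  have hmomi : ∀ i, h i * upSum F φ (insert i I) = moment F φ (insert i I) := fun i => by
    simp only [h]; rw [moment]; ring
  have hrow : ∀ (ψ : Finset α → ℝ) (k : α → ℝ), ∑ i ∈ E, ∑ j ∈ E, pairSum F ψ I i j * k i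
      = (m - 1) * ∑ i ∈ E \ I, k i * upSum F ψ (insert i I) := by
    intro ψ k
    rw [← Finset.sum_subset Finset.sdiff_subset (s₁ := E \ I) (s₂ := E), Finset.mul_sum]
    · refine Finset.sum_congr rfl fun i hi => ?_
      rw [← Finset.sum_mul, hF.sum_pairSum ψ (Finset.mem_sdiff.mp hi).2]
      ring
    · intro i hi hi'
      simp only [Finset.mem_sdiff, not_and, not_not] at hi'
      exact Finset.sum_eq_zero fun j _ => by simp [pairSum, hi' hi]
  have hcol : ∀ (ψ : Finset α → ℝ) (k : α → ℝ), ∑ i ∈ E, ∑ j ∈ E, pairSum F ψ I i j * k j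
      = (m - 1) * ∑ i ∈ E \ I, k i * upSum F ψ (insert i I) := by
    intro ψ k
    rw [← hrow, Finset.sum_comm]
    exact Finset.sum_congr rfl fun i _ => Finset.sum_congr rfl fun j _ => by rw [pairSum_comm]
  set P := ∑ i ∈ E, ∑ j ∈ E,
    (if i = j ∨ i ∈ I ∨ j ∈ I then 0 else moment F φ (insert i (insert j I)))
  set X := ∑ i ∈ E \ I, moment F φ (insert i I) with hX
  have s1 : ∑ i ∈ E, ∑ j ∈ E, pairSum F φ I i j * g i j = P := by
    refine Finset.sum_congr rfl fun i _ => Finset.sum_congr rfl fun j _ => ?_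
    simp only [g, pairSum, moment]
    split_ifs
    · simp
    · ring
  have hX1 : ∑ i ∈ E \ I, h i * upSum F φ (insert i I) = X :=
    Finset.sum_congr rfl fun i _ => hmomi i
  have s2 := hrow φ h
  have s3 := hcol φ h
  have s4 : ∑ i ∈ E, ∑ j ∈ E, pairSum F 1 I i j * h i ^ 2 = (m - 1) * X := by
    rw [hrow 1 (fun i => h i ^ 2), ← hX1]
    congr 1
    refine Finset.sum_congr rfl fun i _ => ?_
    rw [← hNh]; ring
  have s5 : ∑ i ∈ E, ∑ j ∈ E, pairSum F 1 I i j * h j ^ 2 = (m - 1) * X := by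
    rw [hcol 1 (fun i => h i ^ 2), ← hX1]
    congr 1
    refine Finset.sum_congr rfl fun i _ => ?_
    rw [← hNh]; ring
  have hNs : ∑ i ∈ E \ I, h i * upSum F 1 (insert i I) = m * upSum F φ I := by
    rw [hm, ← hF.sum_upSum_insert]
    exact Finset.sum_congr rfl fun i _ => by rw [mul_comm, hNh]
  have s6 := hrow 1 h
  have s7 := hcol 1 h
  rw [hX1] at s2 s3
  rw [hNs] at s6 s7
  have s8 := hF.sum_sum_pairSum φ I
  have s9 := hF.sum_sum_pairSum 1 I
  set q := ∑ i ∈ E, ∑ j ∈ E, pairSum F 1 I i j * h i * h j with hq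
  -- Here g, h and C are the averages of φ over the bases containing I together with two, one or no
  -- further elements; the square is of their mixed second difference.
  have hsq : 0 ≤ ∑ i ∈ E, ∑ j ∈ E, W i j * (g i j - h i - h j + C) ^ 2 :=
    Finset.sum_nonneg fun i _ => Finset.sum_nonneg fun j _ =>
      mul_nonneg (pairSum_one_nonneg I i j) (sq_nonneg _)
  have hexp : ∀ i j, W i j * (g i j - h i - h j + C) ^ 2
      = pairSum F φ I i j * g i j - 2 * (pairSum F φ I i j * h i) - 2 * (pairSum F φ I i j * h j)
        + 2 * C * pairSum F φ I i j + pairSum F 1 I i j * h i ^ 2 + pairSum F 1 I i j * h j ^ 2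
        + 2 * (pairSum F 1 I i j * h i * h j) - 2 * C * (pairSum F 1 I i j * h i)
        - 2 * C * (pairSum F 1 I i j * h j) + C ^ 2 * pairSum F 1 I i j := by
    intro i j
    rw [← hWg]
    simp only [W]
    ring
  simp only [hexp, Finset.sum_add_distrib, Finset.sum_sub_distrib, ← Finset.mul_sum] at hsq
  rw [s1, s2, s3, s4, s5, s6, s7, s8, s9, ← hq, ← hm] at hsq
  -- The only term not reducible to moments is the cross term Σ W h_i h_j; the Lorentzian inequality
  -- at h bounds it.
  have hqle : q ≤ m * (m - 1) * moment F φ I := by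
    rcases (upSum_one_nonneg (F := F) I).eq_or_lt with h0 | h0
    · have hW0 : ∀ i j, pairSum F 1 I i j = 0 := by
        intro i j
        by_contra hne
        obtain ⟨-, -, -, B, hB, hIB⟩ := pairSum_one_ne_zero.mp hne
        refine upSum_one_ne_zero.mpr ⟨B, hB, ?_⟩ h0.symm
        exact ((Finset.subset_insert _ _).trans (Finset.subset_insert _ _)).trans hIB
      rw [hq, moment, ← h0]
      simp [hW0]
    · have hL := hF.lorentzianOn_pairSum hI h
      have s6' : ∑ i ∈ E, (∑ j ∈ E, pairSum F 1 I i j) * h i = (m - 1) * (m * upSum F φ I) := by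
        rw [← s6]
        exact Finset.sum_congr rfl fun i _ => by rw [Finset.sum_mul]
      rw [s6', s9, ← hm, ← hq] at hL
      have hmm : 0 < m * (m - 1) * upSum F 1 I :=
        mul_pos (mul_pos (by linarith) hm1) h0
      refine le_of_mul_le_mul_left (hL.trans_eq ?_) hmm
      rw [moment]
      field_simp
  have e1 : C ^ 2 * (m * (m - 1) * upSum F 1 I) = m * (m - 1) * moment F φ I := by
    rw [← hmom, ← hNC]; ring
  have e2 : 2 * C * (m * (m - 1) * upSum F φ I) = 2 * (m * (m - 1) * moment F φ I) := by
    rw [← hmom]; ring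
  have e3 : 2 * C * ((m - 1) * (m * upSum F φ I)) = 2 * (m * (m - 1) * moment F φ I) := by
    rw [← hmom]; ring
  rw [e1, e2, e3] at hsq
  linarith

/-- Summing the local inequality counts each set of size s + 1 exactly s + 1 times and each set of
size s + 2 exactly (s + 1)(s + 2) times. After division by binomial coefficients this is a_{s+2} -
2a_{s+1} + a_s ≥ 0. -/
theorem sum_moment_convex (φ : Finset α → ℝ) {s : ℕ} (hs : s + 2 ≤ r) :
    0 ≤ ((s : ℝ) + 1) * (s + 2) * (∑ I ∈ E.powersetCard (s + 2), moment F φ I)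
      - 2 * ((r : ℝ) - s - 1) * ((s + 1) * ∑ I ∈ E.powersetCard (s + 1), moment F φ I)
      + ((r : ℝ) - s) * ((r : ℝ) - s - 1) * ∑ I ∈ E.powersetCard s, moment F φ I := by
  have h : 0 ≤ ∑ I ∈ E.powersetCard s,
      ((∑ i ∈ E \ I, ∑ j ∈ E \ insert i I, moment F φ (insert j (insert i I)))
        - 2 * ((r : ℝ) - s - 1) * ∑ i ∈ E \ I, moment F φ (insert i I)
        + ((r : ℝ) - s) * ((r : ℝ) - s - 1) * moment F φ I) := by
    refine Finset.sum_nonneg fun I hI => ?_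
    have hc := (Finset.mem_powersetCard.mp hI).2
    have := hF.moment_convex φ (I := I) (by omega)
    rwa [hc] at this
  rw [Finset.sum_add_distrib, Finset.sum_sub_distrib, ← Finset.mul_sum, ← Finset.mul_sum,
    sum_powersetCard_sum_insert (moment F φ),
    sum_powersetCard_sum_insert (fun K => ∑ j ∈ E \ K, moment F φ (insert j K)),
    sum_powersetCard_sum_insert (moment F φ)] at h
  push_cast at h
  convert h using 3
  ring

theorem sum_moment_card_eq (φ : Finset α → ℝ) :
    ∑ I ∈ E.powersetCard r, moment F φ I = ∑ B ∈ F, φ B ^ 2 := by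
  have hFE : F ⊆ E.powersetCard r := fun B hB =>
    Finset.mem_powersetCard.mpr ⟨hF.subset B hB, hF.card B hB⟩
  have heq : ∀ I ∈ E.powersetCard r, ∀ B ∈ F, I ⊆ B → I = B := fun I hI B hB h =>
    Finset.eq_of_subset_of_card_le h
      (by rw [hF.card B hB, (Finset.mem_powersetCard.mp hI).2])
  rw [← Finset.sum_subset hFE]
  · refine Finset.sum_congr rfl fun B hB => ?_
    have : F.filter (B ⊆ ·) = {B} := by
      ext C
      simp only [Finset.mem_filter, Finset.mem_singleton]
      exact ⟨fun h => (heq B (hFE hB) C h.1 h.2).symm, by rintro rfl; exact ⟨hB, subset_rfl⟩⟩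
    simp [moment, upSum, this]
  · intro I hI hIF
    have : upSum F 1 I = 0 := by
      by_contra h
      obtain ⟨B, hB, hIB⟩ := upSum_one_ne_zero.mp h
      exact hIF (heq I hI B hB hIB ▸ hB)
    simp [moment, this]

/-- In normalised form, (s + 1) a_s ≤ s a_{s+1}: a convex sequence starting at 0 has nondecreasing
slopes from the origin. -/
theorem sum_moment_le_succ {φ : Finset α → ℝ} (hφ : ∑ B ∈ F, φ B = 0) {s : ℕ} (hs : s + 1 ≤ r) :
    ((r : ℝ) - s) * ∑ I ∈ E.powersetCard s, moment F φ I
      ≤ s * ∑ I ∈ E.powersetCard (s + 1), moment F φ I := by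
  induction s with
  | zero => simp [moment, upSum, hφ]
  | succ s ih =>
    have h1 := hF.sum_moment_convex φ hs
    have h2 := ih (by omega)
    have hm : (0 : ℝ) ≤ (r : ℝ) - s - 1 := by
      have : ((s + 1 + 1 : ℕ) : ℝ) ≤ r := by exact_mod_cast hs
      push_cast at this
      linarith
    -- With this weight the level-s term cancels against the one in `h1`; the level s + 1
    -- coefficient becomes 2(s + 1) - s = s + 2, a factor common to both sides.
    have h3 := mul_le_mul_of_nonneg_left h2 hm
    refine le_of_mul_le_mul_left ?_ (show (0 : ℝ) < s + 2 by positivity)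
    push_cast
    rw [show s + 1 + 1 = s + 2 from rfl]
    nlinarith

/-- The variance of the averages over the bases containing a set of corank one contracts. -/
theorem sum_moment_pred_le {φ : Finset α → ℝ} (hφ : ∑ B ∈ F, φ B = 0) (hr : 1 ≤ r) :
    ∑ I ∈ E.powersetCard (r - 1), moment F φ I ≤ ((r : ℝ) - 1) * ∑ B ∈ F, φ B ^ 2 := by
  have h := hF.sum_moment_le_succ hφ (s := r - 1) (by omega)
  rw [show r - 1 + 1 = r by omega, hF.sum_moment_card_eq, Nat.cast_sub hr] at h
  simpa using h

end IsBasisFamily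

end

/-! ### The bases-exchange walk of a matroid -/

theorem card_of_isBase {α : Type*} {M : Matroid α} {B : Finset α} (hB : M.IsBase (B : Set α)) :
    B.card = M.eRank.toNat := by
  rw [← hB.encard_eq_eRank, Set.encard_coe_eq_coe_finsetCard, ENat.toNat_natCast]

section

variable {α : Type*} (M : Matroid α) [M.Finite]

/-- The bases of a matroid on a finite ground set, as a finset of finsets. -/
noncomputable def basesFinset : Finset (Finset α) :=
  (Finset.univ : Finset (Bases M)).map (Function.Embedding.subtype _)

variable {M}

@[simp] theorem mem_basesFinset {B : Finset α} : B ∈ basesFinset M ↔ M.IsBase (B : Set α) := by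
  simp [basesFinset]

theorem sum_basesFinset (φ : Finset α → ℝ) : ∑ B ∈ basesFinset M, φ B = ∑ A : Bases M, φ A.1 := by
  simp [basesFinset, Finset.sum_map]

theorem exists_mem_basesFinset_superset {I : Finset α} :
    (∃ B ∈ basesFinset M, I ⊆ B) ↔ M.Indep (I : Set α) := by
  constructor
  · rintro ⟨B, hB, hIB⟩
    exact (mem_basesFinset.mp hB).indep.subset (Finset.coe_subset.mpr hIB)
  · intro hI
    obtain ⟨B', hB', hIB⟩ := hI.exists_isBase_superset
    obtain ⟨C, rfl⟩ := (hB'.finite).exists_finset_coe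
    exact ⟨C, mem_basesFinset.mpr hB', Finset.coe_subset.mp hIB⟩

open scoped Classical in
variable (M) in
theorem isBasisFamily_basesFinset :
    IsBasisFamily M.ground_finite.toFinset (basesFinset M) M.eRank.toNat where
  subset B hB x hx := M.ground_finite.mem_toFinset.mpr
    ((mem_basesFinset.mp hB).subset_ground hx)
  card B hB := card_of_isBase (mem_basesFinset.mp hB)
  augment I J hI hJ hIJ := by
    rw [exists_mem_basesFinset_superset] at hI hJ
    obtain ⟨x, hx, hxI⟩ := hI.augment hJ (by
      simpa [Set.encard_coe_eq_coe_finsetCard] using hIJ)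
    refine ⟨x, hx.1, by simpa using hx.2, exists_mem_basesFinset_superset.mpr ?_⟩
    simpa using hxI

-- The map f ↦ (A \ {e}) ∪ {f} is a bijection onto the bases containing A \ {e}. Hence the second
-- step of the walk is uniform on a set depending only on A \ {e}, which is what makes P symmetric.
open scoped Classical in
theorem sum_exchangeSet (A : Bases M) {e : α} (he : e ∈ A.1) (g : Finset α → ℝ) :
    ∑ f ∈ exchangeSet M A.1 e, g (exchange A.1 e f) = upSum (basesFinset M) g (A.1.erase e) := by
  have hA := card_of_isBase A.2
  have hI := Finset.card_erase_add_one he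
  have hnot : ∀ f ∈ exchangeSet M A.1 e, f ∉ A.1.erase e := by
    intro f hf hfI
    have h := card_of_isBase (Finset.mem_filter.mp hf).2
    rw [exchange, Finset.insert_eq_of_mem hfI] at h
    omega
  refine Finset.sum_nbij (fun f => exchange A.1 e f) ?_ ?_ ?_ fun _ _ => rfl
  · intro f hf
    rw [Finset.mem_filter, mem_basesFinset]
    exact ⟨(Finset.mem_filter.mp hf).2, Finset.subset_insert _ _⟩
  · intro f hf f' hf' h
    have : f ∈ exchange A.1 e f' := by
      rw [← show exchange A.1 e f = exchange A.1 e f' from h]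
      exact Finset.mem_insert_self _ _
    exact (Finset.mem_insert.mp this).resolve_right (hnot f hf)
  · intro B hB
    rw [Finset.mem_coe, Finset.mem_filter, mem_basesFinset] at hB
    have hBc := card_of_isBase hB.1
    obtain ⟨f, hfB, hf⟩ := Finset.exists_mem_notMem_of_card_lt_card
      (show (A.1.erase e).card < B.card by omega)
    have heq : exchange A.1 e f = B :=
      Finset.eq_of_subset_of_card_le (Finset.insert_subset hfB hB.2)
        (by rw [exchange, Finset.card_insert_of_notMem hf]; omega)
    refine ⟨f, Finset.mem_coe.mpr (Finset.mem_filter.mpr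
      ⟨M.ground_finite.mem_toFinset.mpr (hB.1.subset_ground hfB), ?_⟩), heq⟩
    rw [heq]
    exact hB.1

theorem sum_erase_eq_sum_powersetCard [DecidableEq α] (A : Finset α) (h : Finset α → ℝ) :
    ∑ e ∈ A, h (A.erase e) = if A.card = 0 then 0 else ∑ I ∈ A.powersetCard (A.card - 1), h I := by
  split_ifs with hA
  · rw [Finset.card_eq_zero.mp hA, Finset.sum_empty]
  refine Finset.sum_nbij (fun e => A.erase e) ?_ ?_ ?_ fun _ _ => rfl
  · intro e he
    exact Finset.mem_powersetCard.mpr ⟨Finset.erase_subset _ _, Finset.card_erase_of_mem he⟩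
  · exact Finset.erase_injOn A
  · intro I hI
    obtain ⟨hIA, hIc⟩ := Finset.mem_powersetCard.mp (Finset.mem_coe.mp hI)
    obtain ⟨e, heA, heI⟩ := Finset.exists_mem_notMem_of_card_lt_card
      (show I.card < A.card by omega)
    refine ⟨e, heA, (Finset.eq_of_subset_of_card_le (Finset.subset_erase.mpr ⟨hIA, heI⟩) ?_).symm⟩
    rw [Finset.card_erase_of_mem heA, hIc]

open scoped Classical in
/-- The transition matrix as an average over the independent sets of corank one. -/
theorem transitionMatrix_apply (hr : 1 ≤ M.eRank.toNat) (A B : Bases M) :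
    transitionMatrix M A B = 1 / (M.eRank.toNat : ℝ) *
      ∑ I ∈ M.ground_finite.toFinset.powersetCard (M.eRank.toNat - 1),
        1 / upSum (basesFinset M) 1 I * ((if I ⊆ A.1 then 1 else 0) * if I ⊆ B.1 then 1 else 0) := by
  have hA := card_of_isBase A.2
  have hstep : ∀ e ∈ A.1, (1 / (A.1.card : ℝ)) *
      ∑ f ∈ exchangeSet M A.1 e, (1 / ((exchangeSet M A.1 e).card : ℝ)) *
        (if exchange A.1 e f = B.1 then 1 else 0)
      = 1 / (M.eRank.toNat : ℝ) * (1 / upSum (basesFinset M) 1 (A.1.erase e) *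
          if A.1.erase e ⊆ B.1 then 1 else 0) := by
    intro e he
    have h1 := sum_exchangeSet A he 1
    have h2 := sum_exchangeSet A he (fun C => if C = B.1 then 1 else 0)
    simp only [Pi.one_apply, Finset.sum_const, nsmul_eq_mul, mul_one] at h1
    rw [← Finset.mul_sum, h2, h1, hA]
    congr 2
    rw [upSum, Finset.sum_ite_eq']
    simp [B.2]
  have hpow : A.1.powersetCard (M.eRank.toNat - 1)
      = {I ∈ M.ground_finite.toFinset.powersetCard (M.eRank.toNat - 1) | I ⊆ A.1} := by
    ext I
    simp only [Finset.mem_powersetCard, Finset.mem_filter]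
    have hAE : A.1 ⊆ M.ground_finite.toFinset :=
      (isBasisFamily_basesFinset M).subset _ (mem_basesFinset.mpr A.2)
    exact ⟨fun h => ⟨⟨h.1.trans hAE, h.2⟩, h.1⟩, fun h => ⟨h.2, h.1.2⟩⟩
  rw [transitionMatrix, Matrix.of_apply, Finset.sum_congr rfl hstep, ← Finset.mul_sum,
    sum_erase_eq_sum_powersetCard A.1 (fun I => 1 / upSum (basesFinset M) 1 I *
      if I ⊆ B.1 then 1 else 0), if_neg (by omega), hA, hpow, Finset.sum_filter]
  congr 1
  refine Finset.sum_congr rfl fun I _ => ?_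
  by_cases hI : I ⊆ A.1 <;> simp [hI]

theorem transitionMatrix_isHermitian (hr : 1 ≤ M.eRank.toNat) :
    (transitionMatrix M).IsHermitian := by
  ext A B
  rw [Matrix.conjTranspose_apply, star_trivial, transitionMatrix_apply hr,
    transitionMatrix_apply hr]
  congr 1
  exact Finset.sum_congr rfl fun I _ => by ring

open scoped Classical in
theorem transitionMatrix_quadForm (hr : 1 ≤ M.eRank.toNat) (φ : Finset α → ℝ) :
    ∑ A, ∑ B, transitionMatrix M A B * φ A.1 * φ B.1 = 1 / (M.eRank.toNat : ℝ) *
      ∑ I ∈ M.ground_finite.toFinset.powersetCard (M.eRank.toNat - 1),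
        moment (basesFinset M) φ I := by
  have hup : ∀ I : Finset α, upSum (basesFinset M) φ I
      = ∑ A : Bases M, (if I ⊆ A.1 then 1 else 0) * φ A.1 := by
    intro I
    rw [← sum_basesFinset (fun A => (if I ⊆ A then 1 else 0) * φ A), upSum, Finset.sum_filter]
    exact Finset.sum_congr rfl fun A _ => by split_ifs <;> simp
  have hterm : ∀ A B : Bases M, transitionMatrix M A B * φ A.1 * φ B.1
      = ∑ I ∈ M.ground_finite.toFinset.powersetCard (M.eRank.toNat - 1),
        1 / (M.eRank.toNat : ℝ) * (1 / upSum (basesFinset M) 1 I) *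
        (((if I ⊆ A.1 then 1 else 0) * φ A.1) * ((if I ⊆ B.1 then 1 else 0) * φ B.1)) := by
    intro A B
    rw [transitionMatrix_apply hr, Finset.mul_sum, Finset.sum_mul, Finset.sum_mul]
    exact Finset.sum_congr rfl fun I _ => by ring
  have hswap : ∀ A : Bases M, ∑ B, transitionMatrix M A B * φ A.1 * φ B.1
      = ∑ I ∈ M.ground_finite.toFinset.powersetCard (M.eRank.toNat - 1),
        1 / (M.eRank.toNat : ℝ) * (1 / upSum (basesFinset M) 1 I) *
        (((if I ⊆ A.1 then 1 else 0) * φ A.1) * upSum (basesFinset M) φ I) := by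
    intro A
    simp only [hterm]
    rw [Finset.sum_comm]
    refine Finset.sum_congr rfl fun I _ => ?_
    rw [← Finset.mul_sum, ← Finset.mul_sum, ← hup]
  simp only [hswap]
  rw [Finset.sum_comm, Finset.mul_sum]
  refine Finset.sum_congr rfl fun I _ => ?_
  rw [← Finset.mul_sum, ← Finset.sum_mul, ← hup, moment]
  ring

theorem one_le_eRank_toNat (hM : 2 ≤ Fintype.card (Bases M)) : 1 ≤ M.eRank.toNat := by
  by_contra! h
  have : Subsingleton (Bases M) := by
    refine ⟨fun A B => Subtype.ext ?_⟩
    have hA := card_of_isBase A.2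
    have hB := card_of_isBase B.2
    rw [Finset.card_eq_zero.mp (show A.1.card = 0 by omega),
      Finset.card_eq_zero.mp (show B.1.card = 0 by omega)]
  have := Fintype.card_le_one_iff_subsingleton.mpr this
  omega

theorem transitionMatrix_quadForm_le (hr : 1 ≤ M.eRank.toNat) (x : Bases M → ℝ)
    (hx : ∑ A, x A = 0) : ∑ A, ∑ B, transitionMatrix M A B * x A * x B
      ≤ (1 - 1 / (M.eRank.toNat : ℝ)) * ∑ A, x A ^ 2 := by
  classical
  -- Extension by zero; only the values on bases enter.
  let φ : Finset α → ℝ := fun B => if h : M.IsBase (B : Set α) then x ⟨B, h⟩ else 0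
  have hφ : ∀ A : Bases M, x A = φ A.1 := fun A => by simp [φ, A.2]
  simp only [hφ] at hx ⊢
  rw [← sum_basesFinset φ] at hx
  have hr0 : (0 : ℝ) < M.eRank.toNat := by exact_mod_cast hr
  rw [transitionMatrix_quadForm hr, ← sum_basesFinset (fun B => φ B ^ 2)]
  have := (isBasisFamily_basesFinset M).sum_moment_pred_le hx hr
  calc _ ≤ _ := mul_le_mul_of_nonneg_left this (by positivity)
    _ = _ := by field_simp

end

end BasesExchange

/-- The bases-exchange walk on the bases of a matroid `M` on a finite ground set with at least two
bases (so that the transition matrix has a second eigenvalue) has only real eigenvalues, and its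
spectral gap is at least `1 / r`, where `r` is the rank of `M`. -/
theorem theorem9p1 {α : Type*} (M : Matroid α) [M.Finite]
    (hM : 2 ≤ Fintype.card (BasesExchange.Bases M)) :
    (BasesExchange.transitionMatrix M).charpoly.Splits ∧
      1 / (M.eRank.toNat : ℝ) ≤
        BasesExchange.spectralGap (BasesExchange.transitionMatrix M) := by
  have hr := BasesExchange.one_le_eRank_toNat hM
  have hP := BasesExchange.transitionMatrix_isHermitian hr
  refine ⟨hP.splits_charpoly, ?_⟩
  have := BasesExchange.eigenvalueList_getD_one_le hP hM _
    (BasesExchange.transitionMatrix_quadForm_le hr)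
  rw [BasesExchange.spectralGap]
  linarith
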